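/- Let $X$ be a complex Banach space and let $T$ be a bounded linear operator on $X$. For $\alpha>0$ and $n\in\mathbb N_0$ put $$k^{\alpha}(n)=\frac{\Gamma(\alpha+n)}{\Gamma(\alpha)\,\Gamma(n+1)},\qquad M_T^{\alpha}(n)=\frac{1}{k^{\alpha+1}(n)}\sum_{j=0}^{n}k^{\alpha}(n-j)\,T^j .$$ Let $\alpha>0$ and assume that $T$ is absolutely $(C,\alpha)$-Cesàro bounded, i.e. there is a constant $C>0$ such that $$\sup_{n\in\mathbb N_0}\frac{1}{k^{\alpha+1}(n)}\sum_{j=0}^{n}k^{\alpha}(n-j)\,\|T^jx\|\le C\|x\|\qquad\text{for all }x\in X .$$ Let $\sigma(T)$ be the spectrum of $T$, $\partial\mathbb D$ the unit circle in $\mathbb C$, and $m$ the Lebesgue (arc length) measure on $\partial\mathbb D$. If either (a) $1<\alpha<2$ and $m(\sigma(T)\cap\partial\mathbb D)=0$, or (b) $\alpha\ge 2$, then, in the operator norm, $$\lim_{n\to\infty}\|M_T^{\alpha}(n+1)-M_T^{\alpha}(n)\|=0 .$$ -/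

import Mathlib

noncomputable section

namespace FracCesaro

open MeasureTheory

/-- The Cesàro kernel `k^α(n) = Γ(α + n) / (Γ(α) Γ(n + 1))` for `α > 0`,
and `k^0(n) = δ_{n,0}`. -/
def kernel (α : ℝ) (n : ℕ) : ℝ :=
  if α = 0 then (if n = 0 then 1 else 0)
  else Real.Gamma (α + n) / (Real.Gamma α * Real.Gamma (n + 1))

variable {X : Type*} [NormedAddCommGroup X] [NormedSpace ℂ X]

/-- The Cesàro sum of order `α` of `T`: `∑_{j=0}^n k^α(n - j) T^j`. -/
def cesaroSum (α : ℝ) (T : X →L[ℂ] X) (n : ℕ) : X →L[ℂ] X :=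
  ∑ j ∈ Finset.range (n + 1), (kernel α (n - j) : ℂ) • T ^ j

/-- The Cesàro mean `M_T^α(n)` of order `α` of `T`. -/
def cesaroMean (α : ℝ) (T : X →L[ℂ] X) (n : ℕ) : X →L[ℂ] X :=
  ((kernel (α + 1) n)⁻¹ : ℂ) • cesaroSum α T n

/-- `T` is absolutely `(C, α)`-Cesàro bounded (a notion for `α > 0`): for some `C > 0`, the number
`C * ‖x‖` bounds the supremum over `n` of the weighted means of the `‖T ^ j x‖`, for all `x`. -/
def AbsCesaroBounded (α : ℝ) (T : X →L[ℂ] X) : Prop :=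
  ∃ C : ℝ, 0 < C ∧ ∀ (x : X) (n : ℕ),
    1 / kernel (α + 1) n *
      ∑ j ∈ Finset.range (n + 1), kernel α (n - j) * ‖(T ^ j) x‖ ≤ C * ‖x‖

/-- Lebesgue (arc length) measure of the unit circle, as a Borel measure on `ℂ`: the image of
Lebesgue measure on `(-π, π]` under `θ ↦ exp (i θ)`. -/
def circleMeasure : Measure ℂ :=
  (volume.restrict (Set.Ioc (-Real.pi) Real.pi)).map (fun θ : ℝ => Complex.exp (θ * Complex.I))

end FracCesaro

end

namespace FracCesaro

open Filter Topology

/-! ### Ratios and growth of the Cesàro kernel. -/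

section Kernel

/-! Write `α = β + 1` with `β > 0`. By `cesaroMean_succ_sub`, the difference of means is the
order-`β` Cesàro sum over `k^{β+2}(n+1)`, minus `O(1/n)` times a bounded mean. So it suffices that
the order-`β` sum is `o(k^{β+2}(n))`. Cut it at `n - j = L`. Where `n - j ≥ L`, `k^β ≤ β/(β+L)
k^{β+1}`, so absolute boundedness gives a small multiple of `k^{β+2}(n)`. The other `L` terms are
negligible because `‖T^n‖ = o(k^{α+1}(n))`, which rests on `k^α(n) → ∞` for `α > 1`. -/

lemma kernel_pos {α : ℝ} (hα : 0 < α) (n : ℕ) : 0 < kernel α n := by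
  rw [kernel, if_neg hα.ne']
  have h₁ : 0 < Real.Gamma (α + n) := Real.Gamma_pos_of_pos (by positivity)
  have h₂ : 0 < Real.Gamma α := Real.Gamma_pos_of_pos hα
  have h₃ : 0 < Real.Gamma ((n : ℝ) + 1) := Real.Gamma_pos_of_pos (by positivity)
  positivity

lemma kernel_zero {α : ℝ} (hα : 0 < α) : kernel α 0 = 1 := by
  have h₂ : 0 < Real.Gamma α := Real.Gamma_pos_of_pos hα
  rw [kernel, if_neg hα.ne']
  simp [h₂.ne']

lemma kernel_succ {α : ℝ} (hα : 0 < α) (n : ℕ) :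
    kernel α (n + 1) = kernel α n * ((α + n) / (n + 1)) := by
  rw [kernel, kernel, if_neg hα.ne', if_neg hα.ne']
  have h₂ : 0 < Real.Gamma α := Real.Gamma_pos_of_pos hα
  have h₃ : 0 < Real.Gamma ((n : ℝ) + 1) := Real.Gamma_pos_of_pos (by positivity)
  have h₄ : Real.Gamma (α + ((n + 1 : ℕ) : ℝ)) = (α + n) * Real.Gamma (α + n) := by
    rw [← Real.Gamma_add_one (by positivity)]
    push_cast
    ring_nf
  have h₅ : Real.Gamma (((n + 1 : ℕ) : ℝ) + 1) = (n + 1) * Real.Gamma ((n : ℝ) + 1) := by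
    push_cast
    exact Real.Gamma_add_one (by positivity)
  rw [h₄, h₅]
  field_simp

/-- The kernels of consecutive orders are proportional, with an explicit ratio. -/
lemma kernel_eq_div_mul_kernel_add_one {β : ℝ} (hβ : 0 < β) (n : ℕ) :
    kernel β n = β / (β + n) * kernel (β + 1) n := by
  induction n with
  | zero => simp [kernel_zero hβ, kernel_zero (show 0 < β + 1 by linarith), hβ.ne']
  | succ n ih =>
    rw [kernel_succ hβ, kernel_succ (by linarith : 0 < β + 1), ih]
    push_cast
    field_simp
    ring

lemma kernel_add_one_succ_sub {β : ℝ} (hβ : 0 < β) (n : ℕ) :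
    kernel (β + 1) (n + 1) - kernel (β + 1) n = kernel β (n + 1) := by
  rw [kernel_eq_div_mul_kernel_add_one hβ (n + 1), kernel_succ (by linarith : 0 < β + 1)]
  push_cast
  field_simp
  ring

lemma kernel_monotone {α : ℝ} (hα : 1 ≤ α) : Monotone (kernel α) := by
  refine monotone_nat_of_le_succ fun n => ?_
  rw [kernel_succ (by linarith)]
  refine le_mul_of_one_le_right (kernel_pos (by linarith) n).le ?_
  rw [one_le_div (by positivity)]
  linarith

/-- Each of the `m` successive ratios is `1 + α/(n+i+1) ≤ exp (α/(n+1))`. With `m = n` this yields a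
doubling bound. -/
lemma kernel_add_le {α : ℝ} (hα : 0 < α) (n m : ℕ) :
    kernel (α + 1) (n + m) ≤ kernel (α + 1) n * Real.exp (m * (α / (n + 1))) := by
  induction m with
  | zero => simp
  | succ m ih =>
    have hpos := kernel_pos (by linarith : 0 < α + 1) n
    have hstep : (α + 1 + ((n + m : ℕ) : ℝ)) / (((n + m : ℕ) : ℝ) + 1)
        ≤ Real.exp (α / (n + 1)) := by
      refine le_trans ?_ (Real.add_one_le_exp _)
      have : (α + 1 + ((n + m : ℕ) : ℝ)) / (((n + m : ℕ) : ℝ) + 1)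
          = α / (((n + m : ℕ) : ℝ) + 1) + 1 := by
        field_simp
        ring
      rw [this]
      gcongr
      omega
    rw [← add_assoc, kernel_succ (by linarith : 0 < α + 1)]
    calc kernel (α + 1) (n + m) * ((α + 1 + ((n + m : ℕ) : ℝ)) / (((n + m : ℕ) : ℝ) + 1))
        ≤ (kernel (α + 1) n * Real.exp (m * (α / (n + 1)))) * Real.exp (α / (n + 1)) := by
          gcongr
      _ = kernel (α + 1) n * Real.exp ((m + 1 : ℕ) * (α / (n + 1))) := by
          rw [mul_assoc, ← Real.exp_add]
          push_cast
          ring_nf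

lemma kernel_two_mul_le {α : ℝ} (hα : 0 < α) (n : ℕ) :
    kernel (α + 1) (n + n) ≤ kernel (α + 1) n * Real.exp α := by
  refine (kernel_add_le hα n n).trans ?_
  have hpos := kernel_pos (by linarith : 0 < α + 1) n
  gcongr
  rw [mul_div_assoc', div_le_iff₀ (by positivity)]
  nlinarith

/-- Since `k^α ≥ 1`, the ratio `1 + (α-1)/(n+1)` makes each increment at least `(α-1)/(n+1)`. -/
lemma one_add_mul_harmonic_le_kernel {α : ℝ} (hα : 1 ≤ α) (n : ℕ) :
    1 + (α - 1) * (harmonic n : ℝ) ≤ kernel α n := by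
  induction n with
  | zero => simp [kernel_zero (by linarith : 0 < α)]
  | succ n ih =>
    have h₁ : 1 ≤ kernel α n := by
      rw [← kernel_zero (by linarith : 0 < α)]
      exact kernel_monotone hα n.zero_le
    have h₂ : (α + n) / ((n : ℝ) + 1) = 1 + (α - 1) * ((n : ℝ) + 1)⁻¹ := by
      field_simp
      ring
    have h₃ : 0 ≤ (α - 1) * ((n : ℝ) + 1)⁻¹ := mul_nonneg (by linarith) (by positivity)
    rw [kernel_succ (by linarith), h₂, harmonic_succ]
    push_cast
    nlinarith

lemma tendsto_kernel_atTop {α : ℝ} (hα : 1 < α) : Tendsto (kernel α) atTop atTop := by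
  have h₁ : Tendsto (fun n : ℕ => (harmonic n : ℝ)) atTop atTop := by
    refine tendsto_atTop_mono log_add_one_le_harmonic ?_
    exact Real.tendsto_log_atTop.comp
      (tendsto_natCast_atTop_atTop (R := ℝ) |>.comp (tendsto_add_atTop_nat 1))
  refine tendsto_atTop_mono (one_add_mul_harmonic_le_kernel hα.le) ?_
  exact tendsto_atTop_add_const_left _ _ (h₁.const_mul_atTop (by linarith))

end Kernel

/-! ### Cesàro sums and means of the operator. -/

section Operator

variable {X : Type*} [NormedAddCommGroup X] [NormedSpace ℂ X]

lemma AbsCesaroBounded.exists_sum_le {α : ℝ} (hα : 0 < α) {T : X →L[ℂ] X}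
    (hT : AbsCesaroBounded α T) :
    ∃ C : ℝ, 0 < C ∧ ∀ (x : X) (n : ℕ),
      ∑ j ∈ Finset.range (n + 1), kernel α (n - j) * ‖(T ^ j) x‖
        ≤ C * kernel (α + 1) n * ‖x‖ := by
  obtain ⟨C, hC, h⟩ := hT
  refine ⟨C, hC, fun x n => ?_⟩
  have := h x n
  rw [one_div_mul_eq_div, div_le_iff₀ (kernel_pos (by linarith) n)] at this
  linarith

lemma norm_cesaroSum_apply_le {β : ℝ} (hβ : 0 < β) (T : X →L[ℂ] X) (n : ℕ) (x : X) :
    ‖cesaroSum β T n x‖ ≤ ∑ j ∈ Finset.range (n + 1), kernel β (n - j) * ‖(T ^ j) x‖ := by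
  rw [cesaroSum, sum_apply]
  refine (norm_sum_le _ _).trans_eq (Finset.sum_congr rfl fun j _ => ?_)
  rw [smul_apply, norm_smul, Complex.norm_real,
    Real.norm_of_nonneg (kernel_pos hβ _).le]

/-- An absolutely `(C, α)`-Cesàro bounded operator with `α > 1` has powers of growth strictly
slower than `k^{α+1}(n)`. -/
lemma tendsto_norm_pow_div_kernel {α : ℝ} (hα : 1 < α) {T : X →L[ℂ] X}
    (hT : AbsCesaroBounded α T) :
    Tendsto (fun n => ‖T ^ n‖ / kernel (α + 1) n) atTop (𝓝 0) := by
  obtain ⟨C, hC, h⟩ := hT.exists_sum_le (by linarith)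
  refine squeeze_zero (g := fun n => C * Real.exp α / kernel α n)
    (fun n => div_nonneg (norm_nonneg _) (kernel_pos (by linarith) n).le) (fun n => ?_)
    ((tendsto_kernel_atTop hα).const_div_atTop _)
  have hk := kernel_pos (by linarith : 0 < α) n
  have hk' := kernel_pos (by linarith : 0 < α + 1) n
  rw [div_le_div_iff₀ hk' hk, ← le_div_iff₀ hk]
  refine ContinuousLinearMap.opNorm_le_bound _ (by positivity) fun x => ?_
  rw [div_mul_eq_mul_div, le_div_iff₀ hk]
  -- Keep only the middle term `j = n` of the absolute sum at index `2n`: there `T^n` carries the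
  -- large weight `k^α(n)`.
  calc ‖(T ^ n) x‖ * kernel α n = kernel α (n + n - n) * ‖(T ^ n) x‖ := by
        rw [Nat.add_sub_cancel, mul_comm]
    _ ≤ ∑ j ∈ Finset.range (n + n + 1), kernel α (n + n - j) * ‖(T ^ j) x‖ :=
        Finset.single_le_sum (f := fun j => kernel α (n + n - j) * ‖(T ^ j) x‖)
          (fun j _ => mul_nonneg (kernel_pos (by linarith) _).le (norm_nonneg _))
          (Finset.mem_range.2 (by omega))
    _ ≤ C * kernel (α + 1) (n + n) * ‖x‖ := h x _
    _ ≤ C * (kernel (α + 1) n * Real.exp α) * ‖x‖ := by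
        gcongr
        exact kernel_two_mul_le (by linarith) n
    _ = C * Real.exp α * kernel (α + 1) n * ‖x‖ := by ring

lemma kernel_le_add_ite {β : ℝ} (hβ : 0 < β) (L m : ℕ) :
    kernel β m ≤ β / (β + L) * kernel (β + 1) m + if m < L then kernel β m else 0 := by
  have hk := kernel_pos (by linarith : 0 < β + 1) m
  split_ifs with hm
  · have : 0 ≤ β / (β + L) * kernel (β + 1) m := by positivity
    linarith
  · rw [add_zero, kernel_eq_div_mul_kernel_add_one hβ]
    have : L ≤ m := not_lt.1 hm
    gcongr

/-- The terms of low index of the kernel are bounded through the norms of the powers of `T`, the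
others through the absolute Cesàro bound. -/
lemma norm_cesaroSum_le {β C : ℝ} (hβ : 0 < β) (hC : 0 < C) {T : X →L[ℂ] X}
    (h : ∀ (x : X) (n : ℕ), ∑ j ∈ Finset.range (n + 1), kernel (β + 1) (n - j) * ‖(T ^ j) x‖
      ≤ C * kernel (β + 1 + 1) n * ‖x‖) {L n : ℕ} (hL : L ≤ n) :
    ‖cesaroSum β T n‖ ≤ β / (β + L) * (C * kernel (β + 1 + 1) n)
      + ∑ m ∈ Finset.range L, kernel β m * ‖T ^ (n - m)‖ := by
  have hk := kernel_pos (by linarith : 0 < β + 1 + 1) n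
  have hk₀ := fun m => kernel_pos hβ m
  have hS : 0 ≤ ∑ m ∈ Finset.range L, kernel β m * ‖T ^ (n - m)‖ :=
    Finset.sum_nonneg fun m _ => mul_nonneg (hk₀ m).le (norm_nonneg _)
  -- Work vector by vector: the hypothesis controls sums of `‖T^j x‖`, not of `‖T^j‖`.
  refine ContinuousLinearMap.opNorm_le_bound _ (by positivity) fun x => ?_
  refine (norm_cesaroSum_apply_le hβ T n x).trans ?_
  have hlow : ∑ j ∈ Finset.range (n + 1), (if n - j < L then kernel β (n - j) else 0) * ‖(T ^ j) x‖
      ≤ (∑ m ∈ Finset.range L, kernel β m * ‖T ^ (n - m)‖) * ‖x‖ := by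
    rw [← Finset.sum_range_reflect, Finset.sum_mul]
    calc _ = ∑ m ∈ Finset.range (n + 1),
          if m < L then kernel β m * ‖(T ^ (n - m)) x‖ else 0 := by
          refine Finset.sum_congr rfl fun m hm => ?_
          have hm' : m ≤ n := Nat.lt_succ_iff.1 (Finset.mem_range.1 hm)
          rw [show n + 1 - 1 - m = n - m by omega, show n - (n - m) = m by omega, ite_mul, zero_mul]
      _ = ∑ m ∈ Finset.range L, kernel β m * ‖(T ^ (n - m)) x‖ := by
          rw [← Finset.sum_filter]
          refine Finset.sum_congr ?_ fun _ _ => rfl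
          ext m
          simp only [Finset.mem_filter, Finset.mem_range]
          omega
      _ ≤ _ := by
          refine Finset.sum_le_sum fun m _ => ?_
          rw [mul_assoc]
          exact mul_le_mul_of_nonneg_left (ContinuousLinearMap.le_opNorm _ _) (hk₀ m).le
  calc ∑ j ∈ Finset.range (n + 1), kernel β (n - j) * ‖(T ^ j) x‖
      ≤ ∑ j ∈ Finset.range (n + 1), (β / (β + L) * kernel (β + 1) (n - j)
          + if n - j < L then kernel β (n - j) else 0) * ‖(T ^ j) x‖ :=
        Finset.sum_le_sum fun j _ =>
          mul_le_mul_of_nonneg_right (kernel_le_add_ite hβ L _) (norm_nonneg _)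
    _ = β / (β + L) * ∑ j ∈ Finset.range (n + 1), kernel (β + 1) (n - j) * ‖(T ^ j) x‖
        + ∑ j ∈ Finset.range (n + 1),
          (if n - j < L then kernel β (n - j) else 0) * ‖(T ^ j) x‖ := by
        simp only [add_mul, Finset.sum_add_distrib, Finset.mul_sum, mul_assoc]
    _ ≤ β / (β + L) * (C * kernel (β + 1 + 1) n * ‖x‖)
        + (∑ m ∈ Finset.range L, kernel β m * ‖T ^ (n - m)‖) * ‖x‖ :=
        add_le_add (mul_le_mul_of_nonneg_left (h x n) (by positivity)) hlow
    _ = _ := by ring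

/-- For `β > 0`, the Cesàro sums of order `β` of an absolutely `(C, β + 1)`-Cesàro bounded operator
are negligible with respect to `k^{β+2}(n)`. -/
lemma tendsto_norm_cesaroSum_div_kernel {β : ℝ} (hβ : 0 < β) {T : X →L[ℂ] X}
    (hT : AbsCesaroBounded (β + 1) T) :
    Tendsto (fun n => ‖cesaroSum β T n‖ / kernel (β + 1 + 1) n) atTop (𝓝 0) := by
  have hpow := tendsto_norm_pow_div_kernel (by linarith) hT
  obtain ⟨C, hC, h⟩ := hT.exists_sum_le (by linarith)
  have hk := fun n => kernel_pos (by linarith : 0 < β + 1 + 1) n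
  have hlow (L : ℕ) : Tendsto (fun n => ∑ m ∈ Finset.range L,
      kernel β m * (‖T ^ (n - m)‖ / kernel (β + 1 + 1) (n - m))) atTop (𝓝 0) := by
    have := tendsto_finsetSum (Finset.range L) fun m _ =>
      (hpow.comp (tendsto_sub_atTop_nat m)).const_mul (kernel β m)
    simpa using this
  have hcoef : Tendsto (fun L : ℕ => β / (β + L) * C) atTop (𝓝 0) := by
    have := (tendsto_atTop_add_const_left atTop β
      tendsto_natCast_atTop_atTop).const_div_atTop β |>.mul_const C
    simpa using this
  refine tendsto_order.2 ⟨fun a ha => Eventually.of_forall fun n =>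
    ha.trans_le (div_nonneg (norm_nonneg _) (hk n).le), fun ε hε => ?_⟩
  -- `L` is fixed before `n`, so the remaining sum has a fixed number of terms.
  obtain ⟨L, hL⟩ := (hcoef.eventually_lt_const (half_pos hε)).exists
  filter_upwards [(hlow L).eventually_lt_const (half_pos hε), eventually_ge_atTop L] with n hn hLn
  rw [div_lt_iff₀ (hk n)]
  have hsum : ∑ m ∈ Finset.range L, kernel β m * ‖T ^ (n - m)‖
      ≤ (∑ m ∈ Finset.range L, kernel β m * (‖T ^ (n - m)‖ / kernel (β + 1 + 1) (n - m)))
        * kernel (β + 1 + 1) n := by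
    rw [Finset.sum_mul]
    refine Finset.sum_le_sum fun m _ => ?_
    rw [mul_assoc]
    refine mul_le_mul_of_nonneg_left ?_ (kernel_pos hβ m).le
    rw [div_mul_eq_mul_div, le_div_iff₀ (hk _)]
    exact mul_le_mul_of_nonneg_left (kernel_monotone (by linarith) (Nat.sub_le n m))
      (norm_nonneg _)
  have h₁ := norm_cesaroSum_le hβ hC h hLn
  nlinarith [hk n, mul_lt_mul_of_pos_right hL (hk n), mul_lt_mul_of_pos_right hn (hk n)]

/-- Pascal's rule for the kernels, applied termwise; at `j = n + 1` both kernels equal `1`. -/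
lemma cesaroSum_add_one_succ {β : ℝ} (hβ : 0 < β) (T : X →L[ℂ] X) (n : ℕ) :
    cesaroSum (β + 1) T (n + 1) = cesaroSum (β + 1) T n + cesaroSum β T (n + 1) := by
  simp only [cesaroSum]
  rw [Finset.sum_range_succ _ (n + 1), Finset.sum_range_succ _ (n + 1), ← add_assoc,
    ← Finset.sum_add_distrib, Nat.sub_self, kernel_zero hβ, kernel_zero (by linarith : 0 < β + 1)]
  congr 1
  refine Finset.sum_congr rfl fun j hj => ?_
  have hj' : j ≤ n := Nat.lt_succ_iff.1 (Finset.mem_range.1 hj)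
  rw [Nat.sub_add_comm hj', ← kernel_add_one_succ_sub hβ, ← add_smul]
  push_cast
  ring_nf

lemma cesaroMean_succ_sub {β : ℝ} (hβ : 0 < β) (T : X →L[ℂ] X) (n : ℕ) :
    cesaroMean (β + 1) T (n + 1) - cesaroMean (β + 1) T n
      = ((kernel (β + 1 + 1) (n + 1) : ℂ)⁻¹) • cesaroSum β T (n + 1)
        - (((β + 1) / (β + 2 + n) : ℝ) : ℂ) • cesaroMean (β + 1) T n := by
  have hk : (kernel (β + 1 + 1) n : ℂ) ≠ 0 :=
    Complex.ofReal_ne_zero.2 (kernel_pos (by linarith) n).ne'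
  have h₁ : (n : ℂ) + 1 ≠ 0 := by exact_mod_cast n.succ_ne_zero
  have h₂ : (β + 2 + n : ℂ) ≠ 0 := by
    exact_mod_cast (show (β + 2 + n : ℝ) ≠ 0 by positivity)
  have hcoef : (kernel (β + 1 + 1) (n + 1) : ℂ)⁻¹ = (kernel (β + 1 + 1) n : ℂ)⁻¹
      - (((β + 1) / (β + 2 + n) : ℝ) : ℂ) * (kernel (β + 1 + 1) n : ℂ)⁻¹ := by
    have h₃ : (β + 1 + 1 + n : ℂ) = β + 2 + n := by ring
    rw [kernel_succ (by linarith)]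
    push_cast
    rw [h₃]
    field_simp
    ring
  simp only [cesaroMean]
  rw [cesaroSum_add_one_succ hβ, smul_add, smul_smul]
  nth_rewrite 1 [hcoef]
  rw [sub_smul]
  abel

lemma AbsCesaroBounded.exists_norm_cesaroMean_le {α : ℝ} (hα : 0 < α) {T : X →L[ℂ] X}
    (hT : AbsCesaroBounded α T) : ∃ C : ℝ, ∀ n, ‖cesaroMean α T n‖ ≤ C := by
  obtain ⟨C, hC, h⟩ := hT.exists_sum_le hα
  refine ⟨C, fun n => ?_⟩
  have hk := kernel_pos (by linarith : 0 < α + 1) n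
  rw [cesaroMean, norm_smul, norm_inv, Complex.norm_real, Real.norm_of_nonneg hk.le,
    inv_mul_le_iff₀ hk, mul_comm]
  exact ContinuousLinearMap.opNorm_le_bound _ (by positivity) fun x =>
    (norm_cesaroSum_apply_le hα T n x).trans (h x n)

/-- Consecutive Cesàro means of order `β + 1 > 1` of an absolutely `(C, β + 1)`-Cesàro bounded
operator are asymptotically equal; no condition on the spectrum is needed. -/
lemma tendsto_norm_cesaroMean_succ_sub {β : ℝ} (hβ : 0 < β) {T : X →L[ℂ] X}
    (hT : AbsCesaroBounded (β + 1) T) :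
    Tendsto (fun n => ‖cesaroMean (β + 1) T (n + 1) - cesaroMean (β + 1) T n‖) atTop (𝓝 0) := by
  obtain ⟨C, hC⟩ := hT.exists_norm_cesaroMean_le (by linarith)
  have h₁ := (tendsto_norm_cesaroSum_div_kernel hβ hT).comp (tendsto_add_atTop_nat 1)
  have h₂ : Tendsto (fun n : ℕ => (β + 1) / (β + 2 + n) * C) atTop (𝓝 0) := by
    have := (tendsto_atTop_add_const_left atTop (β + 2)
      tendsto_natCast_atTop_atTop).const_div_atTop (β + 1) |>.mul_const C
    simpa using this
  refine squeeze_zero (fun _ => norm_nonneg _) (fun n => ?_) (by simpa using h₁.add h₂)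
  have hk := kernel_pos (by linarith : 0 < β + 1 + 1) (n + 1)
  rw [cesaroMean_succ_sub hβ]
  refine (norm_sub_le _ _).trans (add_le_add (le_of_eq ?_) ?_)
  · rw [norm_smul, norm_inv, Complex.norm_real, Real.norm_of_nonneg hk.le, inv_mul_eq_div]
  · have : 0 ≤ (β + 1) / (β + 2 + n) := by positivity
    rw [norm_smul, Complex.norm_real, Real.norm_of_nonneg this]
    exact mul_le_mul_of_nonneg_left (hC n) this

end Operator

end FracCesaro

theorem corollary3p4 {X : Type*} [NormedAddCommGroup X] [NormedSpace ℂ X] [CompleteSpace X]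
    (α : ℝ) (T : X →L[ℂ] X) (hT : FracCesaro.AbsCesaroBounded α T)
    (h : (1 < α ∧ α < 2 ∧
        FracCesaro.circleMeasure (spectrum ℂ T ∩ Metric.sphere (0 : ℂ) 1) = 0) ∨ 2 ≤ α) :
    Filter.Tendsto
      (fun n : ℕ => ‖FracCesaro.cesaroMean α T (n + 1) - FracCesaro.cesaroMean α T n‖)
      Filter.atTop (nhds 0) := by
  -- Both alternatives give `α > 1`, so `β = α - 1` is admissible.
  have hα : 0 < α - 1 := by
    rcases h with ⟨h, -, -⟩ | h <;> linarith
  rw [← sub_add_cancel α 1] at hT ⊢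
  exact FracCesaro.tendsto_norm_cesaroMean_succ_sub hα hT
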